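/- Let $q$ be a prime power and let $n\ge 1$. Equip $V=\mathbf F_{q^2}^n$ with the nondegenerate Hermitian form $$\langle u,v\rangle = c\sum_{i=1}^n(-1)^{i+1}u_i v_{n+1-i}^{\,q},$$ where $c\in\mathbf F_{q^2}$ is a constant with $c^{q-1}=(-1)^{n+1}$. Let $\mathrm{GU}_n(q)$ be the group of all $\mathbf F_{q^2}$-linear automorphisms of $V$ preserving this form; it acts on the poset $L$, ordered by inclusion, of all subspaces $0\subsetneq U\subsetneq V$ that are totally isotropic ($U\subseteq U^\perp$). The reduced Euler characteristic of a finite poset $P$ is $\widetilde\chi(P)=\sum_{d\ge -1}(-1)^d c_d(P)$, where $c_d(P)$ is the number of chains in $P$ with $d+1$ elements (so $c_{-1}(P)=1$). For $r\ge 1$ put $$\widetilde\chi_r(\mathrm{GU}_n(q))=\frac1{|\mathrm{GU}_n(q)|}\sum_{X\in\mathrm{Hom}(\mathbf Z^r,\mathrm{GU}_n(q))}\widetilde\chi\bigl(L^{X(\mathbf Z^r)}\bigr),$$ where $L^{X(\mathbf Z^r)}$ is the induced subposet of those $U\in L$ that are invariant under $X(\mathbf Z^r)$. Then: 1. $-\widetilde\chi_1(\mathrm{GU}_n(q))$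 equals $1$ for $n=1$ and $0$ for every $n>1$. 2. $-\widetilde\chi_r(\mathrm{GU}_1(q))=(q+1)^{r-1}$ for every $r\ge 1$. -/

import Mathlib

/-- The reduced Euler characteristic of a finite poset `P`, i.e. of its order complex:
the alternating sum `∑_{d ≥ -1} (-1)^d c_d` where `c_d` is the number of `d`-simplices, that is of
chains with `d + 1` elements.  The empty chain is the single simplex of dimension `-1`. -/
noncomputable def reducedEulerChar (P : Type*) [PartialOrder P] [Finite P] : ℤ :=
  ∑ᶠ s : {s : Finset P // IsChain (· ≤ ·) (s : Set P)}, (-1) ^ (s.1.card + 1)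

/-- There are finitely many homomorphisms from `ℤ^r` to a finite group. -/
instance finite_hom_zpow (r : ℕ) (G : Type*) [Group G] [Finite G] :
    Finite (Multiplicative (Fin r → ℤ) →* G) := by
  have : AddGroup.FG (Fin r → ℤ) := Module.Finite.iff_addGroup_fg.mp inferInstance
  have : Group.FG (Multiplicative (Fin r → ℤ)) := inferInstance
  obtain ⟨S, hS⟩ := Group.fg_def.mp this
  exact Finite.of_injective (fun X (z : S) => X z.1) fun X Y h =>
    MonoidHom.eq_of_eqOn_dense hS fun z hz => congrFun h ⟨z, hz⟩

/-- The `r`th equivariant reduced Euler characteristic of the finite `G`-poset `P`: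
`1/|G|` times the sum, over all homomorphisms `X : ℤ^r → G`, of the reduced Euler characteristic of
the induced subposet of the elements of `P` that are fixed by the image of `X`. -/
noncomputable def equivariantReducedEulerChar (r : ℕ) (P G : Type*) [PartialOrder P] [Finite P]
    [Group G] [Finite G] [MulAction G P] : ℚ :=
  (1 / (Nat.card G : ℚ)) * ∑ᶠ X : Multiplicative (Fin r → ℤ) →* G,
    (reducedEulerChar {x : P // ∀ z, X z • x = x} : ℚ)

section Unitary

variable {F : Type*} [Field F]

/-- The form `⟨u,v⟩ = c ∑_{1 ≤ i ≤ n} (-1)^{i+1} u_i v_{n+1-i}^q` on `F^n` (coordinates are indexed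
from `0` here).  It is used for `|F| = q^2` and `c^{q-1} = (-1)^{n+1}`, when it is a nondegenerate
Hermitian form. -/
def unitaryForm (q n : ℕ) (c : F) (u v : Fin n → F) : F :=
  c * ∑ i : Fin n, (-1) ^ (i : ℕ) * u i * v (Fin.rev i) ^ q

/-- The general unitary group: all linear automorphisms of `F^n` that preserve the form. -/
def GU (q n : ℕ) (c : F) : Subgroup ((Fin n → F) ≃ₗ[F] (Fin n → F)) where
  carrier := {g | ∀ u v, unitaryForm q n c (g u) (g v) = unitaryForm q n c u v}
  mul_mem' {g h} hg hh u v := by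
    rw [LinearEquiv.mul_apply, LinearEquiv.mul_apply, hg, hh]
  one_mem' _ _ := rfl
  inv_mem' {g} hg u v := by
    rw [← hg]
    exact congrArg₂ _ (g.apply_symm_apply u) (g.apply_symm_apply v)

/-- The poset, under inclusion, of nontrivial proper subspaces of `F^n` that are totally isotropic
(`U ⊆ U^⊥`, that is, the form vanishes on `U`). -/
abbrev IsotropicPoset (q n : ℕ) (c : F) : Type _ :=
  {U : Submodule F (Fin n → F) //
    ⊥ < U ∧ U < ⊤ ∧ ∀ u ∈ U, ∀ v ∈ U, unitaryForm q n c u v = 0}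

/-- The general unitary group acts on totally isotropic subspaces by `g • U = g(U)`. -/
instance isotropicAction (q n : ℕ) (c : F) : MulAction (GU q n c) (IsotropicPoset q n c) where
  smul g U := ⟨U.1.map (g.1 : (Fin n → F) →ₗ[F] (Fin n → F)), by
    obtain ⟨U, h1, h2, h3⟩ := U
    refine ⟨?_, ?_, ?_⟩
    · rw [bot_lt_iff_ne_bot] at h1 ⊢
      intro h
      exact h1 (by simpa using h)
    · rw [lt_top_iff_ne_top] at h2 ⊢
      intro h
      apply h2
      rw [eq_top_iff]
      intro x _
      obtain ⟨y, hy, hyx⟩ := (h ▸ Submodule.mem_top : g.1 x ∈ U.map _)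
      exact g.1.injective hyx ▸ hy
    · rintro _ ⟨u, hu, rfl⟩ _ ⟨v, hv, rfl⟩
      exact (g.2 u v).trans (h3 u hu v hv)⟩
  one_smul U := Subtype.ext (Submodule.map_id U.1)
  mul_smul g h U := Subtype.ext (Submodule.map_comp
    (h.1 : (Fin n → F) →ₗ[F] (Fin n → F)) (g.1 : (Fin n → F) →ₗ[F] (Fin n → F)) U.1)

instance finite_linearAut (n : ℕ) [Finite F] : Finite ((Fin n → F) ≃ₗ[F] (Fin n → F)) :=
  Finite.of_injective (fun g => (g : (Fin n → F) → (Fin n → F))) DFunLike.coe_injective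

/-- `χ̃_r(GU_n(q))`: the `r`th equivariant reduced Euler characteristic of the general unitary group
acting on the poset of nontrivial totally isotropic subspaces. -/
noncomputable def chiGU [Finite F] (r q n : ℕ) (c : F) : ℚ :=
  equivariantReducedEulerChar r (IsotropicPoset q n c) (GU q n c)

end Unitary

/-! ### Chains and fixed points of a finite poset with group action -/

section Poset

open Finset

/-! For `r = 1`, interchanging sums turns the total over `g` of the Euler characteristics of the
fixed posets into a signed sum over chains of the orders of their fixers. Group the chains by what
remains after deleting a minimal element of the poset, here an isotropic line. If the fixer of the
remainder `s` is transitive on the lines below `s`, orbit counting gives the chains `insert a s` the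
same total weight as `s`, with opposite sign, so each group cancels
(`sum_reducedEulerChar_fixed_eq_zero`). The transitivity, a special case of Witt's theorem, comes
from explicit Eichler transformations (`exists_isometry_smul_eq`). For `n > 1` the poset is
nonempty, so the sum vanishes. For `n = 1` the poset is empty and each homomorphism contributes
`-1`; the group is cyclic of order `q + 1`, so there are `(q + 1) ^ r` of them. -/

open scoped Classical in
/-- The reduced Euler characteristic of a subposet as a sum over chains of the ambient poset. -/
theorem reducedEulerChar_subtype {P : Type*} [PartialOrder P] [Fintype P] (p : P → Prop) :
    reducedEulerChar {x : P // p x} =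
      ∑ s ∈ ({s : Finset P | IsChain (· ≤ ·) (s : Set P) ∧ ∀ x ∈ s, p x} : Finset (Finset P)),
        (-1) ^ (#s + 1) := by
  rw [reducedEulerChar, finsum_eq_sum_of_fintype]
  refine Finset.sum_bij (fun s _ => s.1.map (Function.Embedding.subtype p)) ?_ ?_ ?_ ?_
  · rintro ⟨s, hs⟩ -
    simp only [mem_filter, mem_univ, true_and, coe_map, mem_map]
    refine ⟨?_, ?_⟩
    · rintro _ ⟨x, hx, rfl⟩ _ ⟨y, hy, rfl⟩ hxy
      exact hs hx hy fun h => hxy (congrArg _ h)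
    · rintro _ ⟨x, -, rfl⟩
      exact x.2
  · rintro s - t - h
    exact Subtype.ext (Finset.map_injective _ h)
  · rintro t ht
    simp only [mem_filter, mem_univ, true_and] at ht
    refine ⟨⟨t.subtype p, ?_⟩, mem_univ _, subtype_map_of_mem ht.2⟩
    intro x hx y hy hxy
    simp only [mem_coe, mem_subtype] at hx hy
    exact ht.1 hx hy fun h => hxy (Subtype.ext h)
  · rintro s -
    rw [card_map]

theorem reducedEulerChar_congr {P : Type*} [PartialOrder P] [Finite P] {p p' : P → Prop}
    (h : p = p') : reducedEulerChar {x : P // p x} = reducedEulerChar {x : P // p' x} := by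
  subst h
  rfl

theorem reducedEulerChar_of_isEmpty (P : Type*) [PartialOrder P] [Finite P] [IsEmpty P] :
    reducedEulerChar P = -1 := by
  have : Unique {s : Finset P // IsChain (· ≤ ·) (s : Set P)} :=
    { default := ⟨∅, by simp⟩
      uniq := fun s => Subtype.ext (Finset.eq_empty_of_isEmpty s.1) }
  rw [reducedEulerChar, finsum_unique, Finset.eq_empty_of_isEmpty (Subtype.val default)]
  simp

open scoped Classical in
/-- A set permuted transitively by the fixer of `s`: the fixers of its points add up in size to the
fixer of `s`. -/
theorem sum_card_fixer_insert {G P : Type*} [Group G] [Fintype G] [MulAction G P]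
    (s X : Finset P) (hX : X.Nonempty)
    (hstab : ∀ g : G, (∀ x ∈ s, g • x = x) → ∀ a ∈ X, g • a ∈ X)
    (htrans : ∀ a ∈ X, ∀ b ∈ X, ∃ g : G, (∀ x ∈ s, g • x = x) ∧ g • a = b) :
    ∑ a ∈ X, #{g : G | ∀ x ∈ insert a s, g • x = x} = #{g : G | ∀ x ∈ s, g • x = x} := by
  obtain ⟨b, hb⟩ := hX
  -- Orbit map at `b`: its fibre over `a` is a coset of the fixer of `insert a s`, reached by right
  -- translation by any `k` taking `b` to `a`.
  rw [Finset.card_eq_sum_card_fiberwise (f := fun g : G => g • b) (t := X)]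
  · refine Finset.sum_congr rfl fun a ha => ?_
    obtain ⟨k, hks, hk⟩ := htrans b hb a ha
    have hks' : ∀ x ∈ s, k⁻¹ • x = x := fun x hx => by rw [inv_smul_eq_iff, hks x hx]
    refine Finset.card_bij (fun g _ => g * k) ?_ ?_ ?_
    · intro g hg
      simp only [mem_filter, mem_univ, true_and, mem_insert, forall_eq_or_imp] at hg ⊢
      refine ⟨fun x hx => ?_, ?_⟩
      · rw [mul_smul, hks x hx, hg.2 x hx]
      · rw [mul_smul, hk, hg.1]
    · intro g _ h _ e
      exact mul_right_cancel e
    · intro g hg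
      simp only [mem_filter, mem_univ, true_and] at hg
      refine ⟨g * k⁻¹, ?_, by simp⟩
      simp only [mem_filter, mem_univ, true_and, mem_insert, forall_eq_or_imp]
      refine ⟨?_, fun x hx => ?_⟩
      · rw [mul_smul, inv_smul_eq_iff.2 hk.symm, hg.2]
      · rw [mul_smul, hks' x hx, hg.1 x hx]
  · intro g hg
    simp only [coe_filter, mem_univ, true_and, Set.mem_ofPred_eq] at hg
    exact hstab g hg b hb

open scoped Classical in
/-- The chains that become `s` after their minimal element of the poset is deleted. -/
theorem chains_over_eq {P : Type*} [PartialOrder P] [Fintype P] {s : Finset P}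
    (hs : IsChain (· ≤ ·) (s : Set P)) (hmin : ∀ x ∈ s, ¬ IsMin x) :
    ({t : Finset P | IsChain (· ≤ ·) (t : Set P) ∧ {x ∈ t | ¬ IsMin x} = s} : Finset (Finset P)) =
      insert s (({a : P | IsMin a ∧ ∀ x ∈ s, a ≤ x} : Finset P).image (insert · s)) := by
  ext t
  simp only [mem_filter, mem_univ, true_and, mem_insert, mem_image]
  constructor
  · rintro ⟨ht, rfl⟩
    by_cases h : ∃ a ∈ t, IsMin a
    · obtain ⟨a, hat, ha⟩ := h
      have hle : ∀ x ∈ t, a ≤ x := fun x hx => by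
        rcases ht.total hat hx with h | h
        · exact h
        · exact ha h
      refine Or.inr ⟨a, ⟨ha, fun x hx => hle x (mem_filter.1 hx).1⟩, ?_⟩
      ext x
      simp only [mem_insert, mem_filter]
      constructor
      · rintro (rfl | h)
        exacts [hat, h.1]
      · intro hx
        by_cases hxm : IsMin x
        · exact Or.inl (hxm.eq_of_le (hle x hx)).symm
        · exact Or.inr ⟨hx, hxm⟩
    · push Not at h
      exact Or.inl (filter_true_of_mem h).symm
  · rintro (rfl | ⟨a, ⟨ha, hle⟩, rfl⟩)
    · exact ⟨hs, filter_true_of_mem hmin⟩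
    · refine ⟨?_, ?_⟩
      · rw [coe_insert]
        exact hs.insert fun x hx _ => Or.inl (hle x hx)
      · rw [filter_insert, if_neg (not_not.2 ha), filter_true_of_mem hmin]

open scoped Classical in
/-- If the fixer of every chain is transitive on the minimal elements below that chain, then the
reduced Euler characteristics of the fixed point posets add up to zero. -/
theorem sum_reducedEulerChar_fixed_eq_zero {G P : Type*} [Group G] [Fintype G]
    [PartialOrder P] [Fintype P] [MulAction G P] [Nonempty P]
    (hmono : ∀ (g : G) (x y : P), x ≤ y → g • x ≤ g • y)
    (htrans : ∀ (s : Finset P), IsChain (· ≤ ·) (s : Set P) → ∀ a b : P, IsMin a → IsMin b →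
      (∀ x ∈ s, a ≤ x) → (∀ x ∈ s, b ≤ x) → ∃ g : G, (∀ x ∈ s, g • x = x) ∧ g • a = b) :
    ∑ g : G, reducedEulerChar {x : P // g • x = x} = 0 := by
  have hMin : ∀ (g : G) (a : P), IsMin a → IsMin (g • a) := fun g a ha b hb => by
    have h := hmono g⁻¹ _ _ hb
    rw [inv_smul_smul] at h
    have h' := hmono g _ _ (ha h)
    rwa [smul_inv_smul] at h'
  have key : ∑ g : G, reducedEulerChar {x : P // g • x = x} =
      ∑ t ∈ ({t : Finset P | IsChain (· ≤ ·) (t : Set P)} : Finset (Finset P)),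
        (-1) ^ (#t + 1) * (#{g : G | ∀ x ∈ t, g • x = x} : ℤ) := by
    simp_rw [reducedEulerChar_subtype]
    rw [sum_comm' (t' := {t : Finset P | IsChain (· ≤ ·) (t : Set P)})
      (s' := fun t => {g : G | ∀ x ∈ t, g • x = x}) (by simp [and_comm])]
    simp_rw [sum_const, nsmul_eq_mul, mul_comm]
  rw [key, ← sum_fiberwise_of_maps_to (g := fun t : Finset P => {x ∈ t | ¬ IsMin x})
    (t := {s : Finset P | IsChain (· ≤ ·) (s : Set P) ∧ ∀ x ∈ s, ¬ IsMin x})]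
  · refine sum_eq_zero fun s hs => ?_
    simp only [mem_filter, mem_univ, true_and] at hs
    obtain ⟨hs, hmin⟩ := hs
    have hnot : ∀ a : P, IsMin a → a ∉ s := fun a ha has => hmin a has ha
    rw [filter_filter, chains_over_eq hs hmin, sum_insert, sum_image]
    · have hne : ({a : P | IsMin a ∧ ∀ x ∈ s, a ≤ x} : Finset P).Nonempty := by
        -- For empty `s` a lower bound exists only because the poset is nonempty.
        obtain ⟨b, hb⟩ : ∃ b : P, ∀ x ∈ s, b ≤ x := by
          rcases s.eq_empty_or_nonempty with rfl | h
          · exact ⟨Classical.arbitrary P, by simp⟩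
          · obtain ⟨b, hb⟩ := s.exists_minimal h
            exact ⟨b, fun x hx => (hs.total hb.1 hx).elim id fun h => hb.2 hx h⟩
        obtain ⟨a, hab, ha⟩ := Finite.exists_le_minimal (p := fun _ : P => True) (a := b) trivial
        exact ⟨a, by simpa using ⟨minimal_true.1 ha, fun x hx => hab.trans (hb x hx)⟩⟩
      have h : ∑ a ∈ ({a : P | IsMin a ∧ ∀ x ∈ s, a ≤ x} : Finset P),
          #{g : G | ∀ x ∈ insert a s, g • x = x} = #{g : G | ∀ x ∈ s, g • x = x} := by
        convert sum_card_fixer_insert (G := G) s _ hne ?_ ?_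
        · intro g hg a ha
          simp only [mem_filter, mem_univ, true_and] at ha ⊢
          exact ⟨hMin g a ha.1, fun x hx => hg x hx ▸ hmono g _ _ (ha.2 x hx)⟩
        · intro a ha b hb
          simp only [mem_filter, mem_univ, true_and] at ha hb
          exact htrans s hs a b ha.1 hb.1 ha.2 hb.2
      have h' : ∀ a ∈ ({a : P | IsMin a ∧ ∀ x ∈ s, a ≤ x} : Finset P),
          (-1 : ℤ) ^ (#(insert a s) + 1) * (#{g : G | ∀ x ∈ insert a s, g • x = x} : ℤ) =
            (-1) ^ (#s) * (#{g : G | ∀ x ∈ insert a s, g • x = x} : ℤ) := fun a ha => by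
        rw [card_insert_of_notMem (hnot a (mem_filter.1 ha).2.1), pow_add, pow_add]
        ring
      rw [sum_congr rfl h', ← mul_sum, ← Nat.cast_sum, h]
      ring
    · intro a ha b hb hab
      have ha' := hnot a (mem_filter.1 ha).2.1
      have : a ∈ insert b s := by
        rw [← show insert a s = insert b s from hab]
        exact mem_insert_self a s
      exact (mem_insert.1 this).resolve_right ha'
    · simp only [mem_image, not_exists, not_and]
      intro a ha h
      exact hnot a (mem_filter.1 ha).2.1 (h ▸ mem_insert_self a s)
  · intro t ht
    simp only [mem_filter, mem_univ, true_and] at ht ⊢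
    exact ⟨ht.mono (coe_subset.2 (filter_subset _ _)), fun x hx => hx.2⟩

end Poset

/-! ### Homomorphisms from free abelian groups -/

section Hom

/-- A homomorphism from the infinite cyclic group is the choice of one element. -/
theorem finsum_hom_int_eq_sum {G P : Type*} [Group G] [Fintype G] [PartialOrder P] [Finite P]
    [MulAction G P] :
    ∑ᶠ X : Multiplicative (Fin 1 → ℤ) →* G, (reducedEulerChar {x : P // ∀ z, X z • x = x} : ℚ) =
      ((∑ g : G, reducedEulerChar {x : P // g • x = x} : ℤ) : ℚ) := by
  let e : G ≃ (Multiplicative (Fin 1 → ℤ) →* G) := (zpowersHom G).trans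
    (MulEquiv.monoidHomCongrLeftEquiv
      (AddEquiv.toMultiplicative (LinearEquiv.funUnique (Fin 1) ℤ ℤ).toAddEquiv.symm))
  have he : ∀ (g : G) (z : Multiplicative (Fin 1 → ℤ)), e g z = g ^ (z.toAdd 0) := fun g z => rfl
  rw [← finsum_comp_equiv e, finsum_eq_sum_of_fintype, Int.cast_sum]
  refine Finset.sum_congr rfl fun g _ => ?_
  have : (fun x : P => ∀ z, e g z • x = x) = fun x => g • x = x := by
    ext x
    simp only [he]
    constructor
    · intro h
      simpa using h (Multiplicative.ofAdd fun _ => 1)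
    · intro h z
      exact (MulAction.stabilizer G x).zpow_mem h _
  rw [reducedEulerChar_congr this]

/-- There are `|G| ^ r` homomorphisms from `ℤ ^ r` to an abelian group `G`. -/
theorem card_hom_int_pow (r : ℕ) (G : Type*) [CommGroup G] :
    Nat.card (Multiplicative (Fin r → ℤ) →* G) = Nat.card G ^ r := by
  have e : (Multiplicative (Fin r → ℤ) →* G) ≃ (Fin r → Additive G) :=
    MonoidHom.toAdditiveRight.trans <| (addMonoidHomLequivInt ℤ).toEquiv.trans
      ((Pi.basisFun ℤ (Fin r)).constr ℤ).symm.toEquiv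
  rw [Nat.card_congr e, Nat.card_fun, Nat.card_congr Additive.toMul]
  simp

end Hom

/-! ### Isometries moving isotropic vectors -/

section Hermitian

variable {F V : Type*} [Field F] [AddCommGroup V] [Module F V] {φ : F →+* F}

/-- The Eichler transformation `v ↦ v + ⟨v,a⟩ w - ⟨v,w⟩ a + μ ⟨v,w⟩ w` of a sesquilinear form. -/
def eichler (B : V →ₗ[F] V →ₛₗ[φ] F) (w a : V) (μ : F) : V →ₗ[F] V :=
  LinearMap.id + (B.flip a).smulRight w - (B.flip w).smulRight a + (μ • B.flip w).smulRight w

theorem eichler_apply (B : V →ₗ[F] V →ₛₗ[φ] F) (w a : V) (μ : F) (v : V) :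
    eichler B w a μ v = v + B v a • w - B v w • a + (μ * B v w) • w := by
  simp [eichler]

/-- Eichler transformations are isometries. -/
theorem eichler_isometry (B : V →ₗ[F] V →ₛₗ[φ] F) (hB : ∀ u v, φ (B u v) = B v u)
    {w a : V} {μ : F} (hww : B w w = 0) (hwa : B w a = 0) (hμ : μ + φ μ = -B a a) (u v : V) :
    B (eichler B w a μ u) (eichler B w a μ v) = B u v := by
  have haw : B a w = 0 := by rw [← hB, hwa, map_zero]
  simp only [eichler_apply, map_add, map_sub, LinearMap.add_apply, LinearMap.sub_apply,
    LinearMap.map_smulₛₗ, LinearMap.smul_apply, smul_eq_mul, RingHom.id_apply, map_mul, hww, hwa,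
    haw, hB]
  -- All other cross terms cancel, leaving `B u w * B w v * (μ + φ μ + B a a)`.
  linear_combination (B u w * B w v) * hμ

/-- Two isotropic vectors are mapped to each other, up to a scalar, by an isometry that preserves
all totally isotropic subspaces containing both of them. -/
theorem exists_isometry_smul_eq (B : V →ₗ[F] V →ₛₗ[φ] F) (hB : ∀ u v, φ (B u v) = B v u)
    (hφ : ∀ x, φ (φ x) = x) (htr : ∀ t, φ t = t → ∃ μ, μ + φ μ = t) (hskew : ∃ s ≠ 0, φ s = -s)
    {x y : V} (hx : B x x = 0) (hy : B y y = 0) (hxy : ∃ a, B x a = 1 ∧ B y a = 1) :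
    ∃ g : V →ₗ[F] V, (∀ u v, B (g u) (g v) = B u v) ∧ (∃ k : F, k ≠ 0 ∧ g x = k • y) ∧
      ∀ U : Submodule F V, x ∈ U → y ∈ U → (∀ u ∈ U, ∀ v ∈ U, B u v = 0) →
        ∀ u ∈ U, g u ∈ U := by
  by_cases h : B x y = 0
  · obtain ⟨a, hxa, hya⟩ := hxy
    have h' : B y x = 0 := by rw [← hB, h, map_zero]
    obtain ⟨μ, hμ⟩ := htr (-B a a) (by rw [map_neg, hB])
    -- On a totally isotropic `U` containing `x` and `y` this map is `u ↦ u + B u a • (y - x)`, and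
    -- `B x a = 1` sends `x` to `y`.
    refine ⟨eichler B (y - x) a μ, eichler_isometry B hB ?_ ?_ hμ, ⟨1, one_ne_zero, ?_⟩, ?_⟩
    · simp [hx, hy, h, h']
    · simp [hxa, hya]
    · simp [eichler_apply, hx, h, hxa]
    · intro U hxU hyU hU u hu
      have hw : y - x ∈ U := U.sub_mem hyU hxU
      rw [eichler_apply, hU u hu _ hw]
      simpa using U.add_mem hu (U.smul_mem _ hw)
  · obtain ⟨s, hs, hs'⟩ := hskew
    -- Scaling `y` so that `B x (k • y)` is skew makes `k • y - x` isotropic; a transvection along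
    -- it then works. No totally isotropic subspace contains both vectors.
    obtain ⟨k, hk⟩ : ∃ k, φ k = s / B x y := ⟨φ (s / B x y), hφ _⟩
    have hk0 : k ≠ 0 := by
      rintro rfl
      rw [map_zero] at hk
      exact div_ne_zero hs h hk.symm
    have hxk : B x (k • y) = s := by
      rw [LinearMap.map_smulₛₗ, smul_eq_mul, hk, div_mul_cancel₀ _ h]
    have hkx : B (k • y) x = -s := by rw [← hB, hxk, hs']
    have hkk : B (k • y) (k • y) = 0 := by simp [hy]
    refine ⟨eichler B (k • y - x) 0 s⁻¹, eichler_isometry B hB ?_ ?_ ?_, ⟨k, hk0, ?_⟩, ?_⟩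
    · rw [map_sub, map_sub, LinearMap.sub_apply, LinearMap.sub_apply, hx, hxk, hkx, hkk]
      ring
    · simp
    · simp [hs', inv_neg]
    · rw [eichler_apply, map_sub, hx, hxk]
      simp [hs]
    · intro U hxU hyU hU
      exact absurd (hU x hxU y hyU) h

end Hermitian

/-! ### Frobenius, skew elements and traces -/

section Frobenius

variable {F : Type*} [Field F] [Finite F] {q : ℕ}

/-- In a field of order `q ^ 2` the map `x ↦ x ^ q` is a ring endomorphism. -/
theorem exists_ringHom_eq_pow (hq : IsPrimePow q) (hF : Nat.card F = q ^ 2) :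
    ∃ φ : F →+* F, ∀ x, φ x = x ^ q := by
  obtain ⟨p, k, hp, hk, rfl⟩ := hq
  have := Fintype.ofFinite F
  obtain ⟨r, hr⟩ := CharP.exists F
  obtain ⟨m, hrp, hm⟩ := FiniteField.card F r
  rw [Nat.card_eq_fintype_card, hm] at hF
  have hrp' : r = p := by
    have : r ∣ (p ^ k) ^ 2 := hF ▸ dvd_pow_self r m.2.ne'
    exact (Nat.prime_dvd_prime_iff_eq hrp hp.nat_prime).1
      (hrp.dvd_of_dvd_pow (hrp.dvd_of_dvd_pow this))
  subst hrp'
  have : Fact r.Prime := ⟨hrp⟩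
  exact ⟨iterateFrobenius F r k, fun x => iterateFrobenius_def r k x⟩

theorem pow_pow_eq_self (hF : Nat.card F = q ^ 2) (x : F) : (x ^ q) ^ q = x := by
  have := Fintype.ofFinite F
  rw [← pow_mul, ← sq, ← hF, Nat.card_eq_fintype_card, FiniteField.pow_card]

/-- `X ^ q - b X` has degree `q`, too few roots for a field of order `q ^ 2`. Taking `b = 1` and `b
= -1` yields elements not fixed by Frobenius and elements of nonzero trace. -/
theorem exists_pow_ne_mul (hq : 1 < q) (hF : Nat.card F = q ^ 2) (b : F) :
    ∃ e : F, e ^ q ≠ b * e := by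
  have := Fintype.ofFinite F
  by_contra! h
  have hdeg : (Polynomial.X ^ q - Polynomial.C b * Polynomial.X : Polynomial F).natDegree = q := by
    have : (Polynomial.C b * Polynomial.X : Polynomial F).natDegree < q :=
      (Polynomial.natDegree_C_mul_le b _).trans_lt (by rwa [Polynomial.natDegree_X])
    rw [Polynomial.natDegree_sub_eq_left_of_natDegree_lt, Polynomial.natDegree_X_pow]
    rwa [Polynomial.natDegree_X_pow]
  have hzero := Polynomial.eq_zero_of_natDegree_lt_card_of_eval_eq_zero'
    (Polynomial.X ^ q - Polynomial.C b * Polynomial.X : Polynomial F) Finset.univ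
    (fun x _ => by simp [h x]) (by
      rw [hdeg, Finset.card_univ, ← Nat.card_eq_fintype_card, hF]
      nlinarith)
  rw [hzero, Polynomial.natDegree_zero] at hdeg
  omega

variable {φ : F →+* F}

theorem exists_skew (hq : 1 < q) (hF : Nat.card F = q ^ 2) (hφ : ∀ x, φ x = x ^ q) :
    ∃ s ≠ 0, φ s = -s := by
  obtain ⟨e, he⟩ := exists_pow_ne_mul hq hF (1 : F)
  rw [one_mul, ← hφ] at he
  refine ⟨e - φ e, sub_ne_zero.2 he.symm, ?_⟩
  rw [map_sub, hφ (φ e), hφ e, pow_pow_eq_self hF]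
  ring

/-- The trace is linear over the fixed field, so an element of nonzero trace can be rescaled. -/
theorem exists_trace_eq (hq : 1 < q) (hF : Nat.card F = q ^ 2) (hφ : ∀ x, φ x = x ^ q) (t : F)
    (ht : φ t = t) : ∃ μ, μ + φ μ = t := by
  obtain ⟨e, he⟩ := exists_pow_ne_mul hq hF (-1 : F)
  rw [← hφ] at he
  have he' : e + φ e ≠ 0 := fun h => he (by linear_combination h)
  have hfix : φ (e + φ e) = e + φ e := by
    rw [map_add, hφ (φ e), hφ e, pow_pow_eq_self hF, add_comm]
  refine ⟨t * e / (e + φ e), ?_⟩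
  rw [map_div₀, hfix, map_mul, ht]
  field_simp

end Frobenius

/-! ### The unitary form and its isotropic lines -/

section Unitary

variable {F : Type*} [Field F] {q n : ℕ} {c : F} {φ : F →+* F}

/-- The form `unitaryForm` as a bundled sesquilinear map. -/
def unitarySesq (hφ : ∀ x, φ x = x ^ q) (n : ℕ) (c : F) :
    (Fin n → F) →ₗ[F] (Fin n → F) →ₛₗ[φ] F :=
  LinearMap.mk₂'ₛₗ (RingHom.id F) φ (unitaryForm q n c)
    (fun u u' v => by
      simp only [unitaryForm, Pi.add_apply, mul_add, add_mul, Finset.sum_add_distrib])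
    (fun k u v => by
      simp only [unitaryForm, Pi.smul_apply, smul_eq_mul, Finset.mul_sum, RingHom.id_apply]
      exact Finset.sum_congr rfl fun i _ => by ring)
    (fun u v v' => by
      simp only [unitaryForm, Pi.add_apply, ← hφ, map_add, mul_add, Finset.sum_add_distrib])
    (fun k u v => by
      simp only [unitaryForm, Pi.smul_apply, smul_eq_mul, Finset.mul_sum, ← hφ, map_mul]
      exact Finset.sum_congr rfl fun i _ => by ring)

/-- Reversing the index changes the signs by `(-1) ^ (n + 1)`, which the condition on `c`
compensates. -/
theorem unitaryForm_symm (hφ : ∀ x, φ x = x ^ q) (hφφ : ∀ x, φ (φ x) = x)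
    (hc : φ c = (-1) ^ (n + 1) * c) (u v : Fin n → F) :
    φ (unitaryForm q n c u v) = unitaryForm q n c v u := by
  simp only [unitaryForm, map_mul, map_sum, map_pow, map_neg, map_one, hc, ← hφ, hφφ]
  rw [← Equiv.sum_comp Fin.revPerm, Finset.mul_sum, Finset.mul_sum]
  refine Finset.sum_congr rfl fun i _ => ?_
  simp only [Fin.revPerm_apply, Fin.rev_rev, Fin.val_rev]
  have : (-1 : F) ^ (n + 1) * (-1) ^ (n - (i + 1)) = (-1) ^ (i : ℕ) := by
    have hi := i.2
    rw [← pow_add, show n + 1 + (n - (i + 1)) = 2 * (n - i) + i by omega, pow_add, pow_mul]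
    simp
  linear_combination (c * φ (u i.rev) * v i) * this

/-- Every linear functional is represented by the form. -/
theorem exists_unitaryForm_eq (hφ : ∀ x, φ x = x ^ q) (hφφ : ∀ x, φ (φ x) = x) (hc : c ≠ 0)
    (f : (Fin n → F) →ₗ[F] F) : ∃ a, ∀ u, unitaryForm q n c u a = f u := by
  refine ⟨fun j => φ ((-1) ^ (j.rev : ℕ) * f (Pi.single j.rev 1) / c), fun u => ?_⟩
  rw [unitaryForm, LinearMap.pi_apply_eq_sum_univ f u, Finset.mul_sum]
  refine Finset.sum_congr rfl fun i _ => ?_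
  rw [← hφ, hφφ, Fin.rev_rev, smul_eq_mul]
  have h1 : ((-1 : F) ^ (i : ℕ)) * (-1) ^ (i : ℕ) = 1 := by rw [← mul_pow]; simp
  have h2 : (fun j => if i = j then 1 else 0 : Fin n → F) = Pi.single i 1 := by
    ext j
    simp [Pi.single_apply, eq_comm]
  rw [h2]
  field_simp
  linear_combination (u i * f (Pi.single i 1)) * h1

theorem eq_zero_of_unitaryForm_eq_zero (hφ : ∀ x, φ x = x ^ q) (hφφ : ∀ x, φ (φ x) = x)
    (hc : c ≠ 0) {u : Fin n → F} (hu : ∀ v, unitaryForm q n c u v = 0) : u = 0 := by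
  ext i
  obtain ⟨a, ha⟩ := exists_unitaryForm_eq (n := n) hφ hφφ hc (LinearMap.proj i)
  simpa [hu] using (ha u).symm

theorem exists_dual_eq_one {V : Type*} [AddCommGroup V] [Module F V] {x y : V}
    (hxy : x ∉ F ∙ y) (hyx : y ∉ F ∙ x) : ∃ f : V →ₗ[F] F, f x = 1 ∧ f y = 1 := by
  obtain ⟨f, hfx, hf⟩ := Submodule.exists_le_ker_of_notMem hxy
  obtain ⟨g, hgy, hg⟩ := Submodule.exists_le_ker_of_notMem hyx
  have hfy : f y = 0 := hf (Submodule.mem_span_singleton_self y)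
  have hgx : g x = 0 := hg (Submodule.mem_span_singleton_self x)
  exact ⟨(f x)⁻¹ • f + (g y)⁻¹ • g, by simp [hgx, hfx], by simp [hfy, hgy]⟩

/-- The minimal totally isotropic subspaces are lines. -/
theorem IsotropicPoset.exists_eq_span (U : IsotropicPoset q n c) (hU : IsMin U) :
    ∃ x, x ≠ 0 ∧ U.1 = F ∙ x := by
  obtain ⟨x, hx, hx0⟩ := U.1.ne_bot_iff.1 U.2.1.ne'
  have hle : F ∙ x ≤ U.1 := (Submodule.span_singleton_le_iff_mem _ _).2 hx
  let W : IsotropicPoset q n c := ⟨F ∙ x, by simpa [bot_lt_iff_ne_bot] using hx0,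
    hle.trans_lt U.2.2.1, fun u hu v hv => U.2.2.2 u (hle hu) v (hle hv)⟩
  exact ⟨x, hx0, le_antisymm (hU (b := W) hle) hle⟩

theorem IsotropicPoset.smul_val (g : GU q n c) (U : IsotropicPoset q n c) :
    (g • U).1 = U.1.map (g.1 : (Fin n → F) →ₗ[F] (Fin n → F)) := rfl

/-- The unitary group is transitive on the isotropic lines contained in a family of totally
isotropic subspaces, even when the family is to be fixed. -/
theorem IsotropicPoset.exists_smul_eq [Finite F] (hq : 1 < q) (hF : Nat.card F = q ^ 2)
    (hφ : ∀ x, φ x = x ^ q) (hc0 : c ≠ 0) (hc : φ c = (-1) ^ (n + 1) * c)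
    {a b : IsotropicPoset q n c} (ha : IsMin a) (hb : IsMin b) :
    ∃ g : GU q n c, (∀ U, a ≤ U → b ≤ U → g • U = U) ∧ g • a = b := by
  by_cases hab : a = b
  · exact ⟨1, fun U _ _ => one_smul _ U, by rw [one_smul, hab]⟩
  have hφφ : ∀ x, φ (φ x) = x := fun x => by rw [hφ, hφ, pow_pow_eq_self hF]
  obtain ⟨x, hx0, hx⟩ := a.exists_eq_span ha
  obtain ⟨y, hy0, hy⟩ := b.exists_eq_span hb
  have hxa : x ∈ a.1 := hx ▸ Submodule.mem_span_singleton_self x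
  have hyb : y ∈ b.1 := hy ▸ Submodule.mem_span_singleton_self y
  have hxy : x ∉ F ∙ y := fun h => hab <| hb.eq_of_le <| show a.1 ≤ b.1 by
    rwa [hx, hy, Submodule.span_singleton_le_iff_mem]
  have hyx : y ∉ F ∙ x := fun h => hab <| (ha.eq_of_le <| show b.1 ≤ a.1 by
    rwa [hx, hy, Submodule.span_singleton_le_iff_mem]).symm
  obtain ⟨f, hfx, hfy⟩ := exists_dual_eq_one hxy hyx
  obtain ⟨v, hv⟩ := exists_unitaryForm_eq hφ hφφ hc0 f
  obtain ⟨g, hg, ⟨k, hk, hgx⟩, hgU⟩ := exists_isometry_smul_eq (unitarySesq hφ n c)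
    (unitaryForm_symm hφ hφφ hc) hφφ (exists_trace_eq hq hF hφ) (exists_skew hq hF hφ)
    (a.2.2.2 x hxa x hxa) (b.2.2.2 y hyb y hyb) ⟨v, (hv x).trans hfx, (hv y).trans hfy⟩
  -- Isometries of a nondegenerate form are injective.
  have hinj : Function.Injective g := by
    rw [injective_iff_map_eq_zero]
    intro u hu
    refine eq_zero_of_unitaryForm_eq_zero hφ hφφ hc0 fun v => ?_
    have := hg u v
    rw [hu, map_zero, LinearMap.zero_apply] at this
    exact this.symm
  let g' : GU q n c := ⟨LinearEquiv.ofInjectiveEndo g hinj, hg⟩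
  refine ⟨g', fun U haU hbU => Subtype.ext ?_, Subtype.ext ?_⟩
  · refine Submodule.eq_of_le_of_finrank_eq ?_ (LinearEquiv.finrank_map_eq g'.1 U.1)
    rintro _ ⟨u, hu, rfl⟩
    exact hgU U.1 (haU hxa) (hbU hyb) U.2.2.2 u hu
  · rw [IsotropicPoset.smul_val, hx, hy, Submodule.map_span, Set.image_singleton]
    change F ∙ g x = F ∙ y
    rw [hgx, Submodule.span_singleton_smul_eq hk.isUnit]

/-- The first basis vector pairs only with the last, which differs from it when `n > 1`. -/
theorem IsotropicPoset.nonempty (hq : q ≠ 0) (hn : 1 < n) (c : F) :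
    Nonempty (IsotropicPoset q n c) := by
  let i : Fin n := ⟨0, by omega⟩
  let j : Fin n := ⟨1, hn⟩
  have hij : j ≠ i := by simp [i, j]
  let x : Fin n → F := Pi.single i 1
  have hx : x ≠ 0 := by simp [x]
  refine ⟨⟨F ∙ x, by simpa [bot_lt_iff_ne_bot] using hx, lt_top_iff_ne_top.2 fun h => ?_, ?_⟩⟩
  · have : Pi.single j 1 ∈ F ∙ x := h ▸ Submodule.mem_top
    obtain ⟨k, hk⟩ := Submodule.mem_span_singleton.1 this
    simpa [x, hij] using congrFun hk j
  · intro u hu v hv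
    obtain ⟨k, rfl⟩ := Submodule.mem_span_singleton.1 hu
    obtain ⟨l, rfl⟩ := Submodule.mem_span_singleton.1 hv
    rw [unitaryForm, Finset.sum_eq_zero, mul_zero]
    intro m _
    by_cases hm : m = i
    · have : m.rev ≠ i := by
        rw [hm, Ne, Fin.ext_iff, Fin.val_rev]
        simp only [i]
        omega
      simp [x, this, hq]
    · simp [x, hm]

theorem chiGU_one_eq_zero [Finite F] (hq : 1 < q) (hF : Nat.card F = q ^ 2)
    (hφ : ∀ x, φ x = x ^ q) (hn : 1 < n) (hc0 : c ≠ 0) (hc : φ c = (-1) ^ (n + 1) * c) :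
    chiGU 1 q n c = 0 := by
  have := IsotropicPoset.nonempty (F := F) (by omega : q ≠ 0) hn c
  have := Fintype.ofFinite (GU q n c)
  have := Fintype.ofFinite (IsotropicPoset q n c)
  rw [chiGU, equivariantReducedEulerChar, finsum_hom_int_eq_sum,
    sum_reducedEulerChar_fixed_eq_zero, Int.cast_zero, mul_zero]
  · intro g U W h
    exact Submodule.map_mono h
  · intro s _ a b ha hb has hbs
    obtain ⟨g, hg, hgab⟩ := IsotropicPoset.exists_smul_eq hq hF hφ hc0 hc ha hb
    exact ⟨g, fun U hU => hg U (has U hU) (hbs U hU), hgab⟩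

end Unitary

/-! ### The group of rank one -/

section RankOne

variable {F : Type*} [Field F] {q : ℕ} {c : F}

instance IsotropicPoset.isEmpty_one : IsEmpty (IsotropicPoset q 1 c) := by
  refine ⟨fun U => ?_⟩
  have : IsSimpleModule F (Fin 1 → F) := isSimpleModule_iff_finrank_eq_one.2 (by simp)
  rcases eq_bot_or_eq_top U.1 with h | h
  · exact U.2.1.ne' h
  · exact U.2.2.1.ne h

theorem unitaryForm_one (u v : Fin 1 → F) : unitaryForm q 1 c u v = c * (u 0 * v 0 ^ q) := by
  simp [unitaryForm]

/-- The unitary group of a line consists of the scalars whose `(q + 1)`st power is one. -/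
theorem nonempty_mulEquiv_GU_one (hc : c ≠ 0) :
    Nonempty ((powMonoidHom (q + 1) : Fˣ →* Fˣ).ker ≃* GU q 1 c) := by
  let ψ : (powMonoidHom (q + 1) : Fˣ →* Fˣ).ker →* GU q 1 c :=
    ((DistribMulAction.toModuleAut F (Fin 1 → F)).comp
      (powMonoidHom (q + 1) : Fˣ →* Fˣ).ker.subtype).codRestrict (GU q 1 c) fun k u v => by
        have hk : (k.1 : F) ^ (q + 1) = 1 := by
          have h : k.1 ^ (q + 1) = 1 := k.2
          rw [← Units.val_pow_eq_pow_val, h, Units.val_one]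
        simp only [unitaryForm_one, MonoidHom.comp_apply, Subgroup.subtype_apply,
          DistribMulAction.toModuleAut_apply, DistribMulAction.toLinearEquiv_apply, Pi.smul_apply,
          Units.smul_def, smul_eq_mul]
        linear_combination (c * u 0 * v 0 ^ q) * hk
  have hψ : ∀ k u, (ψ k).1 u = (k.1 : F) • u := fun k u => rfl
  refine ⟨MulEquiv.ofBijective ψ ⟨?_, ?_⟩⟩
  · intro k l h
    have := congrFun (congrArg (fun g : GU q 1 c => g.1 (fun _ => 1)) h) 0
    simp only [hψ, Pi.smul_apply, smul_eq_mul, mul_one] at this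
    exact Subtype.ext (Units.ext this)
  · intro g
    have hg := g.2 (fun _ => 1) (fun _ => 1)
    have hlin : ∀ u, g.1 u = g.1 (fun _ => 1) 0 • u := fun u => by
      have hu : u = u 0 • (fun _ => 1) := by
        ext i
        rw [Subsingleton.elim i 0]
        simp
      rw [hu, map_smul]
      ext i
      rw [Subsingleton.elim i 0]
      simp [mul_comm]
    rw [unitaryForm_one, unitaryForm_one] at hg
    generalize g.1 (fun _ => 1) 0 = k at hlin hg
    have hk : k ^ (q + 1) = 1 := by
      have := mul_left_cancel₀ hc hg
      rwa [one_pow, one_mul, ← pow_succ'] at this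
    have hk0 : k ≠ 0 := by
      rintro rfl
      simp at hk
    refine ⟨⟨Units.mk0 k hk0, Units.ext ?_⟩, Subtype.ext (LinearEquiv.ext fun u => ?_)⟩
    · simpa using hk
    · rw [hψ, hlin]
      rfl

theorem card_GU_one [Finite F] (hF : Nat.card F = q ^ 2) (hc : c ≠ 0) :
    Nat.card (GU q 1 c) = q + 1 := by
  obtain ⟨e⟩ := nonempty_mulEquiv_GU_one (q := q) hc
  rw [← Nat.card_congr e.toEquiv, IsCyclic.card_powMonoidHom_ker, Nat.card_units, hF]
  -- The unit group is cyclic of order `q ^ 2 - 1 = (q + 1) * (q - 1)`.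
  refine Nat.gcd_eq_right ⟨q - 1, ?_⟩
  simpa using Nat.sq_sub_sq q 1

theorem chiGU_rank_one [Finite F] {r : ℕ} (hr : 1 ≤ r) (hF : Nat.card F = q ^ 2)
    (hc : c ≠ 0) : -chiGU r q 1 c = ((q : ℚ) + 1) ^ (r - 1) := by
  obtain ⟨e⟩ := nonempty_mulEquiv_GU_one (q := q) hc
  have hcard := card_GU_one hF hc
  have hhom : Nat.card (Multiplicative (Fin r → ℤ) →* GU q 1 c) = (q + 1) ^ r := by
    rw [← Nat.card_congr (MulEquiv.monoidHomCongrRightEquiv e), card_hom_int_pow,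
      Nat.card_congr e.toEquiv, hcard]
  have := Fintype.ofFinite (Multiplicative (Fin r → ℤ) →* GU q 1 c)
  simp_rw [chiGU, equivariantReducedEulerChar, reducedEulerChar_of_isEmpty]
  rw [finsum_eq_sum_of_fintype, Finset.sum_const, Finset.card_univ, ← Nat.card_eq_fintype_card,
    hhom, hcard]
  obtain ⟨r, rfl⟩ := Nat.exists_eq_add_of_le' hr
  have : (q : ℚ) + 1 ≠ 0 := by positivity
  simp only [nsmul_eq_mul, Nat.add_sub_cancel]
  push_cast
  field_simp
  exact pow_succ' _ _

end RankOne

theorem proposition5p1 (q : ℕ) (hq : IsPrimePow q) (F : Type*) [Field F] [Finite F]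
    (hF : Nat.card F = q ^ 2) :
    (∀ n : ℕ, 1 ≤ n → ∀ c : F, c ^ (q - 1) = (-1) ^ (n + 1) →
      -chiGU 1 q n c = if n = 1 then 1 else 0) ∧
    (∀ r : ℕ, 1 ≤ r → ∀ c : F, c ^ (q - 1) = (-1) ^ (1 + 1) →
      -chiGU r q 1 c = ((q : ℚ) + 1) ^ (r - 1)) := by
  have hq1 : 1 < q := hq.one_lt
  have hne : ∀ (n : ℕ) (c : F), c ^ (q - 1) = (-1) ^ (n + 1) → c ≠ 0 := by
    rintro n c h rfl
    rw [zero_pow (by omega)] at h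
    exact pow_ne_zero _ (neg_ne_zero.2 one_ne_zero) h.symm
  have hone : ∀ r : ℕ, 1 ≤ r → ∀ c : F, c ^ (q - 1) = (-1) ^ (1 + 1) →
      -chiGU r q 1 c = ((q : ℚ) + 1) ^ (r - 1) := fun r hr c hc =>
    chiGU_rank_one hr hF (hne 1 c hc)
  refine ⟨fun n hn c hc => ?_, hone⟩
  split_ifs with h
  · subst h
    simpa using hone 1 le_rfl c hc
  · obtain ⟨φ, hφ⟩ := exists_ringHom_eq_pow hq hF
    rw [chiGU_one_eq_zero hq1 hF hφ (by omega) (hne n c hc), neg_zero]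
    -- `c ^ q = c ^ (q - 1) * c` is the Hermitian condition on `c`.
    rw [hφ, ← hc, ← pow_succ, Nat.sub_add_cancel hq1.le]
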